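/- Let $(M,g)$ be a Lorentzian manifold and let $\Sigma\subset M$ be a smoothly embedded spacelike hypersurface (for example a Cauchy slice). The light cone of a point $v\in M$ consists of $v$ and all points on null geodesics (future or past directed) through $v$; the lightsphere of $v$ is its intersection with $\Sigma$. A region is a subset $R\subset\Sigma$ with $C^1$ boundary (near each boundary point, $R=\{\varphi\le 0\}$ for a $C^1$ function $\varphi$ with $d\varphi\ne 0$ at that point). The lightsphere of $v$ is externally tangential to $\partial R$ at $p\in\partial R$ if a null geodesic, to the future or to the past, leaves $p$ orthogonally to $\partial R$ on the outer side of $R$ and reaches $v$. The region $R$ is Rindler-convex (tangential condition) if no lightsphere that is externally tangential to $\partial R$ meets the interior of $R$. Let $n\ge 2$ and let $E, A_1,\dots,A_n\subset\Sigma$ be such that $A_1,\dots,A_n$ are adjacent to each other only through $E$, i.e. $\overline{A_i}\cap\overline{A_j}\subset E$ for $i\ne j$. Write juxtaposition for unions, and suppose that $E$, every $A_iE$, every $A_{[n]\setminus\{i\}}E=E\cup\bigcup_{j\ne i}A_j$, and $A_1\cdots A_nE$ are regions with $C^1$ boundary. Then the following two conditions are equivalent: 1. (the geometric condition for $E_{\mathrm{sq}}=0$)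 $A_1E,\dots,A_nE$ and $A_1\cdots A_nE$ are Rindler-convex; 2. (the geometric condition for $\widetilde E_{\mathrm{sq}}=0$) $A_{[n]\setminus\{i\}}E$, for every $i$, and $A_1\cdots A_nE$ are Rindler-convex. Under these conditions $E$ is Rindler-convex as well. In particular, for $n=3$: $AE$, $BE$, $CE$ and $ABCE$ are all Rindler-convex if and only if $ABE$, $BCE$, $ACE$ and $ABCE$ are all Rindler-convex. -/

import Mathlib

open Set Filter Topology Manifold
open scoped ContDiff

noncomputable section

/-- A smooth Lorentzian metric, of signature `(-, +, …, +)`, on a manifold `M` modelled on `E`. -/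
structure LorentzMetric (E : Type*) [NormedAddCommGroup E] [NormedSpace ℝ E]
    (M : Type*) [TopologicalSpace M] [ChartedSpace E M] [IsManifold 𝓘(ℝ, E) ∞ M] where
  /-- the bilinear form on each tangent space -/
  val : ∀ x : M, TangentSpace 𝓘(ℝ, E) x →L[ℝ] TangentSpace 𝓘(ℝ, E) x →L[ℝ] ℝ
  symm : ∀ (x : M) (a b : TangentSpace 𝓘(ℝ, E) x), val x a b = val x b a
  /-- there is a negative direction, and the form is positive definite on its orthogonal -/
  lorentzian : ∀ x : M, ∃ u : TangentSpace 𝓘(ℝ, E) x, val x u u < 0 ∧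
    ∀ w : TangentSpace 𝓘(ℝ, E) x, val x u w = 0 → w ≠ 0 → 0 < val x w w
  smooth : ContMDiff 𝓘(ℝ, E) (𝓘(ℝ, E).prod 𝓘(ℝ, E →L[ℝ] E →L[ℝ] ℝ)) ∞
    (fun x ↦ Bundle.TotalSpace.mk' (E →L[ℝ] E →L[ℝ] ℝ)
      (E := fun x : M ↦ TangentSpace 𝓘(ℝ, E) x →L[ℝ] TangentSpace 𝓘(ℝ, E) x →L[ℝ] ℝ)
      x (val x))

section Spacetime

variable {E : Type*} [NormedAddCommGroup E] [NormedSpace ℝ E]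
  {M : Type*} [TopologicalSpace M] [ChartedSpace E M] [IsManifold 𝓘(ℝ, E) ∞ M]

/-- The components of the metric in the chart centred at `x₀`: the value at the coordinate
point `y` on the coordinate vectors `a` and `b`. -/
def LorentzMetric.coord (g : LorentzMetric E M) (x₀ : M) (y a b : E) : ℝ :=
  g.val ((extChartAt 𝓘(ℝ, E) x₀).symm y)
    (mfderiv 𝓘(ℝ, E) 𝓘(ℝ, E) (extChartAt 𝓘(ℝ, E) x₀).symm y a)
    (mfderiv 𝓘(ℝ, E) 𝓘(ℝ, E) (extChartAt 𝓘(ℝ, E) x₀).symm y b)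

/-- The velocity of a curve in `M`. -/
def velocity (E : Type*) [NormedAddCommGroup E] [NormedSpace ℝ E]
    {M : Type*} [TopologicalSpace M] [ChartedSpace E M] (γ : ℝ → M) (t : ℝ) :
    TangentSpace 𝓘(ℝ, E) (γ t) :=
  mfderiv 𝓘(ℝ, ℝ) 𝓘(ℝ, E) γ t (1 : ℝ)

/-- The curve `γ` is `C²` near `t` and satisfies the geodesic equation at `t`. The equation is
written in the chart centred at `γ t`, in the lowered form
`d/ds (g_{ij} c'^i) = (1/2) (∂_j g_{ik}) c'^i c'^k` for every `j`, which is equivalent to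
`c''^k + Γ^k_{ij} c'^i c'^j = 0`, where `c` is the coordinate expression of `γ`. -/
def LorentzMetric.IsGeodesicAt (g : LorentzMetric E M) (γ : ℝ → M) (t : ℝ) : Prop :=
  ContMDiffAt 𝓘(ℝ, ℝ) 𝓘(ℝ, E) 2 γ t ∧
  ∀ w : E,
    HasDerivAt
      (fun s : ℝ ↦ g.coord (γ t) (extChartAt 𝓘(ℝ, E) (γ t) (γ s))
        (deriv (fun r : ℝ ↦ extChartAt 𝓘(ℝ, E) (γ t) (γ r)) s) w)
      ((1 / 2 : ℝ) * fderiv ℝ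
        (fun y : E ↦ g.coord (γ t) y
          (deriv (fun r : ℝ ↦ extChartAt 𝓘(ℝ, E) (γ t) (γ r)) t)
          (deriv (fun r : ℝ ↦ extChartAt 𝓘(ℝ, E) (γ t) (γ r)) t))
        (extChartAt 𝓘(ℝ, E) (γ t) (γ t)) w)
      t

/-- `γ` restricted to `[0, 1]` is a null geodesic segment, from `γ 0` to `γ 1`. It may be future
directed or past directed. -/
def LorentzMetric.IsNullGeodesic (g : LorentzMetric E M) (γ : ℝ → M) : Prop :=
  ∀ t ∈ Icc (0 : ℝ) 1, g.IsGeodesicAt γ t ∧ velocity E γ t ≠ 0 ∧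
    g.val (γ t) (velocity E γ t) (velocity E γ t) = 0

/-- The (two-sided) light cone with vertex `v`: the vertex together with all the points that lie
on a null geodesic through `v`. -/
def LorentzMetric.lightCone (g : LorentzMetric E M) (v : M) : Set M :=
  {x | x = v ∨ ∃ γ : ℝ → M, g.IsNullGeodesic γ ∧ γ 0 = v ∧ γ 1 = x}

variable {F : Type*} [NormedAddCommGroup F] [NormedSpace ℝ F]
  {S : Type*} [TopologicalSpace S] [ChartedSpace F S]

/-- `ι : S → M` is a smoothly embedded spacelike hypersurface of `(M, g)`. -/
structure LorentzMetric.IsSpacelikeHypersurface (g : LorentzMetric E M) (ι : S → M) : Prop where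
  embedding : IsSmoothEmbedding 𝓘(ℝ, F) 𝓘(ℝ, E) ∞ ι
  codim_one : Module.finrank ℝ E = Module.finrank ℝ F + 1
  spacelike : ∀ (p : S) (w : TangentSpace 𝓘(ℝ, F) p), w ≠ 0 →
    0 < g.val (ι p) (mfderiv 𝓘(ℝ, F) 𝓘(ℝ, E) ι p w) (mfderiv 𝓘(ℝ, F) 𝓘(ℝ, E) ι p w)

/-- The lightsphere with vertex `v`: the intersection of the hypersurface with the light cone. -/
def LorentzMetric.lightSphere (g : LorentzMetric E M) (ι : S → M) (v : M) : Set S :=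
  {q | ι q ∈ g.lightCone v}

/-- `ℓ` is an outward conormal at `p` of the region `R`: near `p`, the region is `{φ ≤ 0}` for a
`C¹` function `φ` whose differential at `p` is `ℓ ≠ 0`. -/
def IsOutwardConormal (R : Set S) (p : S) (ℓ : TangentSpace 𝓘(ℝ, F) p → ℝ) : Prop :=
  ∃ φ : S → ℝ, ContMDiffAt 𝓘(ℝ, F) 𝓘(ℝ, ℝ) 1 φ p ∧
    (∀ᶠ q in 𝓝 p, q ∈ R ↔ φ q ≤ 0) ∧
    (∀ w : TangentSpace 𝓘(ℝ, F) p, ℓ w = mfderiv 𝓘(ℝ, F) 𝓘(ℝ, ℝ) φ p w) ∧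
    ∃ w : TangentSpace 𝓘(ℝ, F) p, ℓ w ≠ 0

/-- `R` is a region with `C¹` boundary: it has an outward conormal at each boundary point.
(Such a set is closed.) -/
def IsRegularRegion (F : Type*) [NormedAddCommGroup F] [NormedSpace ℝ F]
    {S : Type*} [TopologicalSpace S] [ChartedSpace F S] (R : Set S) : Prop :=
  ∀ p ∈ frontier R, ∃ ℓ : TangentSpace 𝓘(ℝ, F) p → ℝ, IsOutwardConormal R p ℓ

/-- The lightsphere with vertex `v` is externally tangential to the boundary of `R` at `p`: a null
geodesic (to the future or to the past) leaves `p` orthogonally to the boundary of `R`, on the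
outer side of `R`, and reaches `v`. Indeed `g(k, ·)`, for the initial velocity `k`, is a conormal
at `p` of the lightsphere, which points to the side of the vertex; tangency means that it is also
a conormal of the boundary of `R`, and external tangency that it points out of `R`. -/
def LorentzMetric.IsExternallyTangent (F : Type*) [NormedAddCommGroup F] [NormedSpace ℝ F]
    {S : Type*} [TopologicalSpace S] [ChartedSpace F S]
    (g : LorentzMetric E M) (ι : S → M) (R : Set S) (p : S) (v : M) : Prop :=
  ∃ γ : ℝ → M, g.IsNullGeodesic γ ∧ γ 0 = ι p ∧ γ 1 = v ∧
    IsOutwardConormal (F := F) R p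
      (fun w ↦ g.val (γ 0) (velocity E γ 0) (mfderiv 𝓘(ℝ, F) 𝓘(ℝ, E) ι p w : E))

/-- Rindler convexity (tangential condition): no lightsphere that is externally tangential to the
boundary of `R` reaches the inside of `R`. -/
def LorentzMetric.RindlerConvex (F : Type*) [NormedAddCommGroup F] [NormedSpace ℝ F]
    {S : Type*} [TopologicalSpace S] [ChartedSpace F S]
    (g : LorentzMetric E M) (ι : S → M) (R : Set S) : Prop :=
  ∀ p ∈ frontier R, ∀ v : M, g.IsExternallyTangent F ι R p v →
    Disjoint (g.lightSphere ι v) (interior R)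

/-- The geometric condition for `E_sq = 0`: the regions `A₁E, …, AₙE` and `A₁⋯AₙE` are
Rindler-convex (the region `E` is called `K` here). -/
def LorentzMetric.SqCondition (F : Type*) [NormedAddCommGroup F] [NormedSpace ℝ F]
    {S : Type*} [TopologicalSpace S] [ChartedSpace F S]
    (g : LorentzMetric E M) (ι : S → M) {n : ℕ} (A : Fin n → Set S) (K : Set S) : Prop :=
  (∀ i, g.RindlerConvex F ι (A i ∪ K)) ∧ g.RindlerConvex F ι ((⋃ i, A i) ∪ K)

/-- The geometric condition for the other version `Ẽ_sq = 0`: for each `i` the region obtained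
from `A₁⋯AₙE` by leaving out `Aᵢ`, and `A₁⋯AₙE` itself, are Rindler-convex. -/
def LorentzMetric.SqTildeCondition (F : Type*) [NormedAddCommGroup F] [NormedSpace ℝ F]
    {S : Type*} [TopologicalSpace S] [ChartedSpace F S]
    (g : LorentzMetric E M) (ι : S → M) {n : ℕ} (A : Fin n → Set S) (K : Set S) : Prop :=
  (∀ i, g.RindlerConvex F ι ((⋃ j ∈ {j | j ≠ i}, A j) ∪ K)) ∧
    g.RindlerConvex F ι ((⋃ i, A i) ∪ K)

end Spacetime

end

/-! ### Conormals of nested regions at a common boundary point -/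

section Conormal

variable {F : Type*} [NormedAddCommGroup F] [NormedSpace ℝ F]
  {S : Type*} [TopologicalSpace S] [ChartedSpace F S]

/-! If `R ⊆ R'` share a boundary point, their outward conormals there are positive multiples of each
other (`IsOutwardConormal.exists_pos_mul_of_subset`), so both have the same externally tangential
lightspheres at that point. Convexity of `R'` thus handles those boundary points of `R` that are
also boundary points of `R'`. From 2 to 1, `A i ∪ K` is the intersection of the regions omitting one
`A k`, `k ≠ i`, so each of its boundary points is a boundary point of one of them. In the same way
`K` is the intersection of two sets `A i ∪ K`. From 1 to 2, a boundary point outside `K` is a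
boundary point of the full union. At one in `K`, the lightsphere is tangent to every `A j ∪ K`, `j ≠
i`, and avoids their interiors. These interiors fill the interior of the union: at a leftover point
all the boundaries would share an outward direction, which `iUnion_notMem_nhds_of_mem_frontier`
excludes. -/

/-- The curve through `p` which is a straight line in the chart centred at `p`. -/
noncomputable def chartLine (p : S) (w : F) (t : ℝ) : S :=
  (extChartAt 𝓘(ℝ, F) p).symm (extChartAt 𝓘(ℝ, F) p p + t • w)

lemma chartLine_zero (p : S) (w : F) : chartLine p w 0 = p := by
  simp [chartLine]

lemma tendsto_chartLine (p : S) (w : F) : Tendsto (chartLine p w) (𝓝 0) (𝓝 p) := by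
  have h1 : ContinuousAt (extChartAt 𝓘(ℝ, F) p).symm (extChartAt 𝓘(ℝ, F) p p) :=
    continuousAt_extChartAt_symm p
  have h2 : Tendsto (fun t : ℝ ↦ extChartAt 𝓘(ℝ, F) p p + t • w) (𝓝 0)
      (𝓝 (extChartAt 𝓘(ℝ, F) p p)) := by
    have : Continuous (fun t : ℝ ↦ extChartAt 𝓘(ℝ, F) p p + t • w) := by fun_prop
    simpa using this.tendsto 0
  have h3 := h1.tendsto.comp h2
  rwa [extChartAt_to_inv] at h3

lemma hasDerivAt_comp_chartLine {φ : S → ℝ} {p : S}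
    (hφ : MDifferentiableAt 𝓘(ℝ, F) 𝓘(ℝ, ℝ) φ p) (w : F) :
    HasDerivAt (fun t ↦ φ (chartLine p w t)) (mfderiv 𝓘(ℝ, F) 𝓘(ℝ, ℝ) φ p w) 0 := by
  have h := hφ.hasMFDerivAt.2
  simp only [writtenInExtChartAt, modelWithCornersSelf_coe, range_id,
    extChartAt_model_space_eq_id, PartialEquiv.refl_coe,
    Function.id_comp] at h
  have hl : HasDerivAt (fun t : ℝ ↦ extChartAt 𝓘(ℝ, F) p p + t • w) w 0 := by
    simpa using ((hasDerivAt_id (0 : ℝ)).smul_const w).const_add (extChartAt 𝓘(ℝ, F) p p)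
  have h0 : extChartAt 𝓘(ℝ, F) p p = extChartAt 𝓘(ℝ, F) p p + (0 : ℝ) • w := by simp
  have h' := h
  rw [h0] at h'
  exact h'.comp_hasDerivAt (0 : ℝ) hl (Eventually.of_forall fun _ ↦ mem_univ _)

/-- A defining function vanishes at the boundary. -/
lemma eq_zero_of_mem_frontier {R : Set S} {p : S} (hp : p ∈ frontier R) {φ : S → ℝ}
    (hφ : ContinuousAt φ p) (hR : ∀ᶠ q in 𝓝 p, q ∈ R ↔ φ q ≤ 0) : φ p = 0 := by
  rw [frontier_eq_closure_inter_closure] at hp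
  apply le_antisymm
  · by_contra! h
    have h1 := hφ.eventually (lt_mem_nhds h)
    obtain ⟨q, h2, h3, h4⟩ := ((mem_closure_iff_frequently.1 hp.1).and_eventually
      (hR.and h1)).exists
    exact absurd (h3.1 h2) (not_le.2 h4)
  · by_contra! h
    have h1 := hφ.eventually (gt_mem_nhds h)
    obtain ⟨q, h2, h3, h4⟩ := ((mem_closure_iff_frequently.1 hp.2).and_eventually
      (hR.and h1)).exists
    exact h2 (h3.2 (le_of_lt h4))

lemma IsRegularRegion.isClosed {R : Set S} (h : IsRegularRegion F R) : IsClosed R := by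
  rw [← closure_subset_iff_isClosed, closure_eq_self_union_frontier]
  rintro p (hp | hp)
  · exact hp
  · obtain ⟨ℓ, φ, hφ, hR, -⟩ := h p hp
    exact hR.self_of_nhds.2 (eq_zero_of_mem_frontier hp hφ.continuousAt hR).le

/-- The defining function vanishes at `p`, so its derivative along the chart line fixes its sign
just after `p`. -/
lemma IsOutwardConormal.eventually_notMem {R : Set S} {p : S} (hp : p ∈ frontier R)
    {ℓ : TangentSpace 𝓘(ℝ, F) p → ℝ} (h : IsOutwardConormal R p ℓ)
    {w : F} (hw : 0 < ℓ w) :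
    ∀ᶠ t in 𝓝[>] (0 : ℝ), chartLine (F := F) p w t ∉ R := by
  obtain ⟨φ, hφ, hR, hℓ, -⟩ := h
  have h0 := eq_zero_of_mem_frontier hp hφ.continuousAt hR
  have hd := hasDerivAt_comp_chartLine (hφ.mdifferentiableAt one_ne_zero) w
  rw [hℓ w] at hw
  have h1 := (hasDerivAt_iff_tendsto_slope.1 hd).mono_left
    (nhdsWithin_mono 0 (fun t (ht : 0 < t) ↦ ht.ne'))
  filter_upwards [h1.eventually (lt_mem_nhds hw), self_mem_nhdsWithin,
    ((tendsto_chartLine (F := F) p w).mono_left nhdsWithin_le_nhds).eventually hR] with t h2 h3 h4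
  rw [h4, not_le]
  simp only [slope_def_field, chartLine_zero, h0, sub_zero] at h2
  exact (div_pos_iff_of_pos_right h3).1 h2

lemma IsOutwardConormal.eventually_mem {R : Set S} {p : S} (hp : p ∈ frontier R)
    {ℓ : TangentSpace 𝓘(ℝ, F) p → ℝ} (h : IsOutwardConormal R p ℓ)
    {w : F} (hw : ℓ w < 0) :
    ∀ᶠ t in 𝓝[>] (0 : ℝ), chartLine (F := F) p w t ∈ R := by
  obtain ⟨φ, hφ, hR, hℓ, -⟩ := h
  have h0 := eq_zero_of_mem_frontier hp hφ.continuousAt hR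
  have hd := hasDerivAt_comp_chartLine (hφ.mdifferentiableAt one_ne_zero) w
  rw [hℓ w] at hw
  have h1 := (hasDerivAt_iff_tendsto_slope.1 hd).mono_left
    (nhdsWithin_mono 0 (fun t (ht : 0 < t) ↦ ht.ne'))
  filter_upwards [h1.eventually (gt_mem_nhds hw), self_mem_nhdsWithin,
    ((tendsto_chartLine (F := F) p w).mono_left nhdsWithin_le_nhds).eventually hR] with t h2 h3 h4
  rw [h4]
  simp only [slope_def_field, chartLine_zero, h0, sub_zero] at h2
  by_contra! h5
  exact absurd (div_pos h5 h3) h2.not_gt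

/-- By perturbation `L' ≤ 0` on the kernel of `L`; the kernel is symmetric under negation, so `L'`
vanishes on it. -/
lemma exists_pos_smul_of_neg_imp_nonpos {V : Type*} [AddCommGroup V] [Module ℝ V]
    {L L' : V →ₗ[ℝ] ℝ} (hL : ∃ w, L w ≠ 0) (hL' : ∃ w, L' w ≠ 0)
    (h : ∀ w, L w < 0 → L' w ≤ 0) : ∃ c : ℝ, 0 < c ∧ ∀ w, L' w = c * L w := by
  obtain ⟨u₀, hu₀⟩ := hL
  obtain ⟨u, hu⟩ : ∃ u, L u = 1 := ⟨(L u₀)⁻¹ • u₀, by simp [hu₀]⟩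
  have hpos : 0 ≤ L' u := by
    have := h (-u) (by simp [hu])
    simpa using this
  have hker : ∀ z, L z = 0 → L' z ≤ 0 := by
    intro z hz
    refine le_of_forall_pos_le_add fun ε hε ↦ ?_
    -- The summand `1` avoids division by zero when `L' u = 0`.
    have hd : 0 < L' u + 1 := by linarith
    have h1 := h (z - (ε / (L' u + 1)) • u) (by simp [hz, hu]; positivity)
    simp only [map_sub, map_smul, smul_eq_mul] at h1
    have h2 : ε / (L' u + 1) * L' u ≤ ε := by
      rw [div_mul_eq_mul_div, div_le_iff₀ hd]
      nlinarith
    linarith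
  have hmul : ∀ w, L' w = L' u * L w := by
    intro w
    have h1 := hker (w - L w • u) (by simp [hu])
    have h2 := hker (-(w - L w • u)) (by simp [hu])
    simp only [map_neg, map_sub, map_smul, smul_eq_mul] at h1 h2
    linarith
  refine ⟨L' u, lt_of_le_of_ne hpos fun h0 ↦ ?_, hmul⟩
  obtain ⟨w, hw⟩ := hL'
  exact hw (by rw [hmul w, ← h0, zero_mul])

/-- Nested regions with a common boundary point have proportional conormals there. -/
lemma IsOutwardConormal.exists_pos_mul_of_subset {R R' : Set S} {p : S} (hRR' : R ⊆ R')
    (hp : p ∈ frontier R) (hp' : p ∈ frontier R') {ℓ ℓ' : TangentSpace 𝓘(ℝ, F) p → ℝ}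
    (h : IsOutwardConormal R p ℓ) (h' : IsOutwardConormal R' p ℓ') :
    ∃ c : ℝ, 0 < c ∧ ∀ w, ℓ' w = c * ℓ w := by
  have key : ∀ w, ℓ w < 0 → ℓ' w ≤ 0 := by
    intro w hw
    by_contra! hw'
    obtain ⟨t, h1, h2⟩ := ((h.eventually_mem hp hw).and (h'.eventually_notMem hp' hw')).exists
    exact h2 (hRR' h1)
  obtain ⟨φ, -, -, hφ, hn⟩ := h
  obtain ⟨ψ, -, -, hψ, hn'⟩ := h'
  obtain rfl : ℓ = fun w ↦ mfderiv 𝓘(ℝ, F) 𝓘(ℝ, ℝ) φ p w := funext hφ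
  obtain rfl : ℓ' = fun w ↦ mfderiv 𝓘(ℝ, F) 𝓘(ℝ, ℝ) ψ p w := funext hψ
  let L : F →L[ℝ] ℝ := mfderiv 𝓘(ℝ, F) 𝓘(ℝ, ℝ) φ p
  let L' : F →L[ℝ] ℝ := mfderiv 𝓘(ℝ, F) 𝓘(ℝ, ℝ) ψ p
  exact exists_pos_smul_of_neg_imp_nonpos (V := F) (L := L.toLinearMap) (L' := L'.toLinearMap)
    hn hn' key

lemma IsOutwardConormal.of_pos_mul {R : Set S} {p : S} {ℓ ℓ' : TangentSpace 𝓘(ℝ, F) p → ℝ}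
    (h : IsOutwardConormal R p ℓ) {c : ℝ} (hc : 0 < c) (hℓ : ∀ w, ℓ' w = c * ℓ w) :
    IsOutwardConormal R p ℓ' := by
  obtain ⟨φ, hφ, hR, hd, w, hw⟩ := h
  refine ⟨c • φ, (contDiff_const_smul c).contMDiff.contMDiffAt.comp p hφ, ?_, fun v ↦ ?_, w, ?_⟩
  · filter_upwards [hR] with q hq
    rw [hq, Pi.smul_apply, smul_eq_mul, ← not_lt, ← not_lt, mul_pos_iff_of_pos_left hc]
  · rw [hℓ, hd, const_smul_mfderiv (hφ.mdifferentiableAt one_ne_zero)]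
    rfl
  · rw [hℓ]
    exact mul_ne_zero hc.ne' hw

lemma IsOutwardConormal.of_subset {R R' : Set S} {p : S} {ℓ : TangentSpace 𝓘(ℝ, F) p → ℝ}
    (h : IsOutwardConormal R p ℓ) (hR' : IsRegularRegion F R') (hRR' : R ⊆ R')
    (hp : p ∈ frontier R) (hp' : p ∈ frontier R') : IsOutwardConormal R' p ℓ := by
  obtain ⟨ℓ', h'⟩ := hR' p hp'
  obtain ⟨c, hc, hℓ⟩ := h.exists_pos_mul_of_subset hRR' hp hp' h'
  exact h'.of_pos_mul (inv_pos.2 hc) fun w ↦ by rw [hℓ, inv_mul_cancel_left₀ hc.ne']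

lemma IsOutwardConormal.of_superset {R R' : Set S} {p : S} {ℓ : TangentSpace 𝓘(ℝ, F) p → ℝ}
    (h : IsOutwardConormal R' p ℓ) (hR : IsRegularRegion F R) (hRR' : R ⊆ R')
    (hp : p ∈ frontier R) (hp' : p ∈ frontier R') : IsOutwardConormal R p ℓ := by
  obtain ⟨ℓ', h'⟩ := hR p hp
  obtain ⟨c, hc, hℓ⟩ := h'.exists_pos_mul_of_subset hRR' hp hp' h
  exact h'.of_pos_mul hc hℓ

/-- Finitely many regions, all containing a given region and sharing a boundary point with it,
do not cover a neighbourhood of that point. -/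
lemma iUnion_notMem_nhds_of_mem_frontier {J : Type*} [Finite J] {R : J → Set S} {K : Set S}
    {q : S} (hK : IsRegularRegion F K) (hR : ∀ j, IsRegularRegion F (R j))
    (hKR : ∀ j, K ⊆ R j) (hqK : q ∈ frontier K) (hq : ∀ j, q ∈ frontier (R j)) :
    (⋃ j, R j) ∉ 𝓝 q := by
  intro hU
  obtain ⟨ℓ, h⟩ := hK q hqK
  obtain ⟨w, hw⟩ : ∃ w, 0 < ℓ w := by
    obtain ⟨φ, -, -, hφ, w, hw⟩ := h
    rcases hw.lt_or_gt with hw | hw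
    · refine ⟨-w, ?_⟩
      rw [hφ] at hw ⊢
      rw [map_neg]
      exact neg_pos.2 hw
    · exact ⟨w, hw⟩
  -- One `ℓ` is an outward conormal of every `R j`, so a single direction leaves all of them;
  -- finiteness gives a common small `t`.
  have h1 : ∀ᶠ t in 𝓝[>] (0 : ℝ), ∀ j, chartLine (F := F) q w t ∉ R j :=
    eventually_all.2 fun j ↦
      (h.of_subset (hR j) (hKR j) hqK (hq j)).eventually_notMem (hq j) hw
  obtain ⟨t, h2, h3⟩ := (h1.and
    (((tendsto_chartLine (F := F) q w).mono_left nhdsWithin_le_nhds).eventually hU)).exists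
  obtain ⟨j, hj⟩ := mem_iUnion.1 h3
  exact h2 j hj

end Conormal

lemma mem_frontier_of_subset {S : Type*} [TopologicalSpace S] {R R' : Set S} {p : S}
    (hRR' : R ⊆ R') (hpR : p ∈ R) (hp : p ∈ frontier R') : p ∈ frontier R :=
  ⟨subset_closure hpR, fun h ↦ hp.2 (interior_mono hRR' h)⟩

/-! ### Transfer of tangency and convexity between nested regions -/

section Convex

variable {E : Type*} [NormedAddCommGroup E] [NormedSpace ℝ E]
  {M : Type*} [TopologicalSpace M] [ChartedSpace E M] [IsManifold 𝓘(ℝ, E) ∞ M]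
  {F : Type*} [NormedAddCommGroup F] [NormedSpace ℝ F]
  {S : Type*} [TopologicalSpace S] [ChartedSpace F S]
  {g : LorentzMetric E M} {ι : S → M} {R R' : Set S} {p : S} {v : M}

lemma LorentzMetric.IsExternallyTangent.of_subset (h : g.IsExternallyTangent F ι R p v)
    (hR' : IsRegularRegion F R') (hRR' : R ⊆ R') (hp : p ∈ frontier R)
    (hp' : p ∈ frontier R') : g.IsExternallyTangent F ι R' p v := by
  obtain ⟨γ, h1, h2, h3, h4⟩ := h
  exact ⟨γ, h1, h2, h3, h4.of_subset hR' hRR' hp hp'⟩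

lemma LorentzMetric.IsExternallyTangent.of_superset (h : g.IsExternallyTangent F ι R' p v)
    (hR : IsRegularRegion F R) (hRR' : R ⊆ R') (hp : p ∈ frontier R)
    (hp' : p ∈ frontier R') : g.IsExternallyTangent F ι R p v := by
  obtain ⟨γ, h1, h2, h3, h4⟩ := h
  exact ⟨γ, h1, h2, h3, h4.of_superset hR hRR' hp hp'⟩

/-- Rindler-convexity of a larger region with the same boundary point. -/
lemma LorentzMetric.RindlerConvex.disjoint_of_subset (h : g.RindlerConvex F ι R')
    (hR' : IsRegularRegion F R') (hRR' : R ⊆ R') (hp : p ∈ frontier R)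
    (hp' : p ∈ frontier R') (hv : g.IsExternallyTangent F ι R p v) :
    Disjoint (g.lightSphere ι v) (interior R) :=
  (h p hp' v (hv.of_subset hR' hRR' hp hp')).mono_right (interior_mono hRR')

end Convex

/-! ### Sets that touch only inside `K` -/

section Separated

variable {S : Type*} [TopologicalSpace S] {n : ℕ} {A : Fin n → Set S} {K : Set S}

/-- Away from `K`, only one of the sets is present near a given point. -/
lemma eventually_notMem_of_closure_inter_subset
    (hsep : ∀ i j, i ≠ j → closure (A i) ∩ closure (A j) ⊆ K) {q : S} (hq : q ∉ K)
    {i : Fin n} (hi : q ∈ A i) : ∀ᶠ x in 𝓝 q, ∀ j, j ≠ i → x ∉ A j := by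
  refine eventually_all.2 fun j ↦ eventually_imp_distrib_left.2 fun hj ↦ ?_
  have h : q ∉ closure (A j) := fun h ↦ hq (hsep j i hj ⟨h, subset_closure hi⟩)
  filter_upwards [isClosed_closure.isOpen_compl.mem_nhds h] with x hx hxA
  exact hx (subset_closure hxA)

/-- A point outside `A i ∪ K` lies in some `A j`; omitting that `j` puts it in a second `A l`, hence
in `K` by separation. -/
lemma mem_of_forall_mem_iUnion_ne (hn : 2 ≤ n)
    (hsep : ∀ i j, i ≠ j → closure (A i) ∩ closure (A j) ⊆ K) {x : S} {i : Fin n}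
    (h : ∀ k, k ≠ i → x ∈ (⋃ j ∈ {j | j ≠ k}, A j) ∪ K) : x ∈ A i ∪ K := by
  by_contra hx
  rw [mem_union, not_or] at hx
  have h' : ∀ k, k ≠ i → ∃ j, j ≠ k ∧ x ∈ A j := by
    intro k hk
    simpa [hx.2] using h k hk
  have : Nontrivial (Fin n) := Fin.nontrivial_iff_two_le.2 hn
  obtain ⟨k, hk⟩ := exists_ne i
  obtain ⟨j, -, hj⟩ := h' k hk
  obtain ⟨l, hlj, hl⟩ := h' j (fun e ↦ hx.1 (e ▸ hj))
  exact hx.2 (hsep l j hlj ⟨subset_closure hl, subset_closure hj⟩)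

end Separated

/-! ### The equivalence and the convexity of `K` -/

theorem mainTheorem7
    {E : Type*} [NormedAddCommGroup E] [NormedSpace ℝ E] [FiniteDimensional ℝ E]
    {M : Type*} [TopologicalSpace M] [ChartedSpace E M] [IsManifold 𝓘(ℝ, E) ∞ M]
    {F : Type*} [NormedAddCommGroup F] [NormedSpace ℝ F] [FiniteDimensional ℝ F]
    {S : Type*} [TopologicalSpace S] [ChartedSpace F S] [IsManifold 𝓘(ℝ, F) ∞ S]
    (g : LorentzMetric E M) (ι : S → M) (hι : g.IsSpacelikeHypersurface (F := F) ι)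
    {n : ℕ} (hn : 2 ≤ n) (A : Fin n → Set S) (K : Set S)
    (hsep : ∀ i j, i ≠ j → closure (A i) ∩ closure (A j) ⊆ K)
    (hK : IsRegularRegion F K)
    (hA : ∀ i, IsRegularRegion F (A i ∪ K))
    (hA' : ∀ i, IsRegularRegion F ((⋃ j ∈ {j | j ≠ i}, A j) ∪ K))
    (hX : IsRegularRegion F ((⋃ i, A i) ∪ K)) :
    (g.SqCondition F ι A K ↔ g.SqTildeCondition F ι A K) ∧
      (g.SqCondition F ι A K → g.RindlerConvex F ι K) := by
  have : Nontrivial (Fin n) := Fin.nontrivial_iff_two_le.2 hn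
  have hAB : ∀ i j, j ≠ i → A j ∪ K ⊆ (⋃ j ∈ {j | j ≠ i}, A j) ∪ K := fun i j hj ↦
    union_subset_union_left K (subset_biUnion_of_mem (u := A) (x := j) hj)
  refine ⟨⟨fun h ↦ ⟨fun i p hp v hv ↦ ?_, h.2⟩, fun h ↦ ⟨fun i p hp v hv ↦ ?_, h.2⟩⟩,
    fun h p hp v hv ↦ ?_⟩
  · have hpB := (hA' i).isClosed.frontier_subset hp
    by_cases hpK : p ∈ K
    · have hj : ∀ j, j ≠ i → Disjoint (g.lightSphere ι v) (interior (A j ∪ K)) := by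
        intro j hj
        have hp' := mem_frontier_of_subset (hAB i j hj) (Or.inr hpK) hp
        exact h.1 j p hp' v (hv.of_superset (hA j) (hAB i j hj) hp' hp)
      rw [Set.disjoint_left]
      intro q hqv hq
      have hq' : ∀ j, j ≠ i → q ∉ interior (A j ∪ K) := fun j hji ↦
        Set.disjoint_left.1 (hj j hji) hqv
      have hqB : (⋃ j ∈ {j | j ≠ i}, A j) ∪ K ∈ 𝓝 q := mem_interior_iff_mem_nhds.1 hq
      by_cases hqK : q ∈ K
      · obtain ⟨k, hk⟩ := exists_ne i
        -- Here `q` is a boundary point of `K` and of every `A j ∪ K` with `j ≠ i`, yet these cover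
        -- a neighbourhood of `q`.
        refine iUnion_notMem_nhds_of_mem_frontier (J := {j // j ≠ i}) (R := fun j ↦ A j ∪ K)
          hK (fun j ↦ hA j) (fun j ↦ subset_union_right)
          ⟨subset_closure hqK, fun h' ↦ hq' k hk (interior_mono subset_union_right h')⟩
          (fun j ↦ ⟨subset_closure (Or.inr hqK), hq' j j.2⟩) ?_
        filter_upwards [hqB] with x hx
        rcases hx with hx | hx
        · obtain ⟨j, hji, hxj⟩ := mem_iUnion₂.1 hx
          exact mem_iUnion.2 ⟨⟨j, hji⟩, Or.inl hxj⟩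
        · exact mem_iUnion.2 ⟨⟨k, hk⟩, Or.inr hx⟩
      · obtain ⟨j, hji, hqj⟩ := mem_iUnion₂.1 ((interior_subset hq).resolve_right hqK)
        refine hq' j hji (mem_interior_iff_mem_nhds.2 ?_)
        filter_upwards [hqB, eventually_notMem_of_closure_inter_subset hsep hqK hqj]
          with x hx hxj
        rcases hx with hx | hx
        · obtain ⟨l, -, hxl⟩ := mem_iUnion₂.1 hx
          by_cases hlj : l = j
          · exact Or.inl (hlj ▸ hxl)
          · exact absurd hxl (hxj l hlj)
        · exact Or.inr hx
    · obtain ⟨j, hji, hpj⟩ := mem_iUnion₂.1 (hpB.resolve_right hpK)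
      have hBX : (⋃ j ∈ {j | j ≠ i}, A j) ∪ K ⊆ (⋃ i, A i) ∪ K :=
        union_subset_union_left K (iUnion₂_subset fun j _ ↦ subset_iUnion A j)
      -- Near `p` only `A j` and `K` are present, so adding `A i` changes nothing there and `p`
      -- stays on the boundary.
      refine h.2.disjoint_of_subset hX hBX hp ⟨subset_closure (hBX hpB), fun hpX ↦ hp.2 ?_⟩ hv
      rw [mem_interior_iff_mem_nhds] at hpX ⊢
      filter_upwards [hpX, eventually_notMem_of_closure_inter_subset hsep hpK hpj] with x hx hxj
      rcases hx with hx | hx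
      · obtain ⟨l, hxl⟩ := mem_iUnion.1 hx
        by_cases hlj : l = j
        · exact hAB i j hji (Or.inl (hlj ▸ hxl))
        · exact absurd hxl (hxj l hlj)
      · exact Or.inr hx
  · have hpA := (hA i).isClosed.frontier_subset hp
    -- Otherwise `p` would be interior to a finite intersection contained in `A i ∪ K`.
    obtain ⟨k, hk, hpk⟩ : ∃ k, k ≠ i ∧ p ∉ interior ((⋃ j ∈ {j | j ≠ k}, A j) ∪ K) := by
      by_contra! hcon
      have hall : ∀ᶠ x in 𝓝 p, ∀ k, k ≠ i → x ∈ (⋃ j ∈ {j | j ≠ k}, A j) ∪ K :=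
        eventually_all.2 fun k ↦ eventually_imp_distrib_left.2 fun hk ↦
          mem_interior_iff_mem_nhds.1 (hcon k hk)
      exact hp.2 (mem_interior_iff_mem_nhds.2
        (hall.mono fun x hx ↦ mem_of_forall_mem_iUnion_ne hn hsep hx))
    exact (h.1 k).disjoint_of_subset (hA' k) (hAB k i hk.symm) hp
      ⟨subset_closure (hAB k i hk.symm hpA), hpk⟩ hv
  · have hpK := hK.isClosed.frontier_subset hp
    obtain ⟨i, hi⟩ : ∃ i, p ∉ interior (A i ∪ K) := by
      by_contra! hcon
      obtain ⟨i, j, hij⟩ := exists_pair_ne (Fin n)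
      refine hp.2 (mem_interior_iff_mem_nhds.2 ?_)
      filter_upwards [mem_interior_iff_mem_nhds.1 (hcon i),
        mem_interior_iff_mem_nhds.1 (hcon j)] with x hxi hxj
      by_contra hx
      exact hx (hsep i j hij ⟨subset_closure (hxi.resolve_right hx),
        subset_closure (hxj.resolve_right hx)⟩)
    exact (h.1 i).disjoint_of_subset (hA i) subset_union_right hp
      ⟨subset_closure (Or.inr hpK), hi⟩ hv
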